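/- **Setting.** Let $M$ be a compact metric space with metric $\rho$ on which a group $G$ acts by isometries and 2-point-homogeneously: whenever $\rho(x,y)=\rho(x',y')$ there is $g\in G$ with $gx=x'$, $gy=y'$. Let $\mu$ be a $G$-invariant Borel probability measure on $M$, let $\tau(x,y)=F(\rho(x,y))$ for a function $F:\mathbb R\to\mathbb R$, put $\tau_0=F(0)=\tau(x,x)$ and $T=\{\tau(x,y):x,y\in M\}$. Let $D\in\mathbb N\cup\{\infty\}$ and let $\Phi=(\Phi_k)_{0\le k\le D}$ be the zonal spherical functions of $M$, assumed to be polynomials of degree $k$. That is, $L^2(M,\mu)$ is the closure of the sum of pairwise orthogonal, finite-dimensional, irreducible $G$-stable spaces $V_k$ ($0\le k\le D$) of continuous complex functions; $\Phi_k(\tau(x,y))$ is a real multiple of $\sum_i\varphi_i(x)\overline{\varphi_i(y)}$, where $(\varphi_i)$ is an orthonormal basis of $V_k$; $\Phi_k(t)=\sum_{d=0}^k p_{kd}t^d$ is a real polynomial of degree $k$; and $\Phi_k(\tau_0)=1$. ($D$ is finite when $M$ is finite.) Let $S=T\cap[a,b]$. An $S$-code is a finite set $C\subset M$ with $\tau(x,y)\in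 S$ for all distinct $x,y\in C$. For $\Pi\subseteq M$ let $A(\Pi,S)$ be the largest size of an $S$-code contained in $\Pi$ ($+\infty$ if these sizes are unbounded). Let $q_1,\dots,q_r\in M$, $-\infty\le\alpha_i\le\beta_i\le\infty$, and $$\Pi_1=\{x\in M:\ \alpha_i\le\tau(x,q_i)\le\beta_i,\ i=1,\dots,r\}.$$ Let $\ell\ge1$ and $a=u_1<u_2<\dots<u_{\ell+1}=b$. For a code $C$ let $x_i^{(k)}(C)$ be the sum of $\tau(x,y)^k$ over the ordered pairs of distinct points $x,y\in C$ with $\tau(x,y)\in[u_i,u_{i+1})$ (with $\tau(x,y)\in[u_\ell,b]$ if $i=\ell$). Let $Ad$ be a (possibly empty) set of linear matrix inequalities with real symmetric matrices, each involving $c$ and finitely many of the variables $x_i^{(k)}$ ($1\le i\le\ell$, $k\ge0$), such that for every $S$-code $C\subseteq\Pi$ all of them hold at $c=|C|$, $x_i^{(k)}=x_i^{(k)}(C)$. For real $s_0,\dots,s_{2m-1}$ let $H_m(s_0,\dots,s_{2m-1},[\alpha,\beta])$ be the block diagonal matrix with the three $m\times m$ blocks $(s_{i+j})$, $(s_{i+j+1}-\alpha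 s_{i+j})$, $(\beta s_{i+j}-s_{i+j+1})$, $0\le i,j<m$; a block with an infinite endpoint is omitted. **The program.** For $m\ge1$ let $c^*(m)\in[-\infty,\infty]$ be the supremum of $c$ over all real $c$, $x_i^{(k)}$ $(1\le i\le\ell)$ and $y_i^{(k)}$ $(1\le i\le r)$, $0\le k\le 2m-1$ (together with any further $x_i^{(k)}$ that occur in $Ad$), subject to * (7) $H_m(x_i^{(0)},\dots,x_i^{(2m-1)},[u_i,u_{i+1}])\succeq0$ for $1\le i\le\ell$; * (8) all the constraints in $Ad$; * (9) $G_k\succeq0$ for $0\le k\le\min(2m-1,D)$, where $G_k$ is the symmetric $(r+1)\times(r+1)$ matrix with entries $(G_k)_{ij}=\Phi_k(\tau(q_i,q_j))$ for $i,j\le r$, $(G_k)_{i,r+1}=\sum_{d=0}^k p_{kd}\,y_i^{(d)}$ for $i\le r$, and $(G_k)_{r+1,r+1}=c+\sum_{d=0}^k p_{kd}\sum_{i=1}^{\ell}x_i^{(d)}$; moreover $y_i^{(0)}=c$ for $1\le i\le r$; * (10) $H_m(y_i^{(0)},\dots,y_i^{(2m-1)},[\alpha_i,\beta_i])\succeq0$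 for $1\le i\le r$. Let $SDPA(\Pi_1,\Phi,[a,b],Ad)=\inf_{m\ge1}c^*(m)$. **Theorem.** If $\Pi\subseteq\Pi_1$, then for every $m\ge1$ $$A(\Pi,S)\ \le\ SDPA(\Pi_1,\Phi,[a,b],Ad)\ \le\ c^*(m).$$ -/

import Mathlib

open MeasureTheory Polynomial

noncomputable section

namespace SDPCodes

/-! ### Two-point-homogeneous spaces and zonal spherical functions -/

/-- A group `G` acting by isometries on a metric space `M` acts two-point-homogeneously: any two
pairs of points at the same distance are related by an element of `G`. -/
def IsTwoPointHomogeneous (G M : Type*) [MetricSpace M] [Group G] [MulAction G M]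
    [IsIsometricSMul G M] : Prop :=
  ∀ x y x' y' : M, dist x y = dist x' y' → ∃ g : G, g • x = x' ∧ g • y = y'

section Zonal

variable {M : Type*} [MetricSpace M] (G : Type*) [Group G] [MulAction G M] [IsIsometricSMul G M]

/-- A space of continuous functions on `M` is stable under the translations
`f ↦ (x ↦ f (g⁻¹ • x))`. -/
def IsInvariantSpace (V : Submodule ℂ C(M, ℂ)) : Prop :=
  ∀ g : G, ∀ f ∈ V, ∃ f' ∈ V, ∀ x, f' x = f (g⁻¹ • x)

/-- An irreducible `G`-stable space of continuous functions. -/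
def IsIrreducibleSpace (V : Submodule ℂ C(M, ℂ)) : Prop :=
  V ≠ ⊥ ∧ IsInvariantSpace G V ∧ ∀ W ≤ V, IsInvariantSpace G W → W = ⊥ ∨ W = V

/-- `Φ` is, up to a real factor, the zonal spherical function of the finite-dimensional space `V`:
`Φ (τ(x,y))` is proportional to `∑ i, φ i x * conj (φ i y)`, where `φ` is an orthonormal basis of
`V` for the inner product of `L²(μ)`. -/
def IsZonalOf [MeasurableSpace M] (μ : Measure M) (τ : M → M → ℝ) (V : Submodule ℂ C(M, ℂ))
    (Φ : ℝ[X]) : Prop :=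
  ∃ (n : ℕ) (φ : Fin n → C(M, ℂ)) (κ : ℝ),
    Submodule.span ℂ (Set.range φ) = V ∧
    (∀ i j, ∫ x, φ i x * (starRingEnd ℂ) (φ j x) ∂μ = if i = j then 1 else 0) ∧
    ∀ x y, (((Φ.eval (τ x y) : ℝ)) : ℂ) = κ * ∑ i, φ i x * (starRingEnd ℂ) (φ i y)

/-- The polynomials `Φ k`, `0 ≤ k ≤ D`, are the zonal spherical functions of `M` with respect to
`τ(x,y) = F (dist x y)`: `L²(μ)` is the closure of the sum of pairwise orthogonal irreducible
`G`-stable finite-dimensional spaces `V k`, `0 ≤ k ≤ D`, the function `Φ k` is the zonal spherical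
function of `V k`, it is a polynomial of degree `k`, and `Φ k (τ₀) = 1` with `τ₀ = τ(x,x) = F 0`.
Here `D = ⊤` if there are infinitely many spaces, while `D` is finite for a finite space `M`. -/
def IsZonalFamily [CompactSpace M] [MeasurableSpace M] [BorelSpace M]
    (μ : Measure M) [IsFiniteMeasure μ] (F : ℝ → ℝ) (D : ℕ∞) (Φ : ℕ → ℝ[X]) : Prop :=
  ∃ V : ℕ → Submodule ℂ C(M, ℂ),
    (∀ k : ℕ, (k : ℕ∞) ≤ D → IsIrreducibleSpace G (V k)) ∧
    (∀ j k : ℕ, (j : ℕ∞) ≤ D → (k : ℕ∞) ≤ D → j ≠ k →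
      ∀ f ∈ V j, ∀ h ∈ V k, ∫ x, f x * (starRingEnd ℂ) (h x) ∂μ = 0) ∧
    (⨆ (k : ℕ) (_ : (k : ℕ∞) ≤ D),
      (V k).map (ContinuousMap.toLp 2 μ ℂ).toLinearMap).topologicalClosure = ⊤ ∧
    ∀ k : ℕ, (k : ℕ∞) ≤ D →
      IsZonalOf μ (fun x y => F (dist x y)) (V k) (Φ k) ∧
      (Φ k).degree = (k : WithBot ℕ) ∧ (Φ k).eval (F 0) = 1

end Zonal

/-! ### Codes -/

section Codes

variable {M : Type*} (τ : M → M → ℝ)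

/-- `S = T ∩ [a,b]`, where `T` is the set of all values of `τ`. -/
def valueSet (a b : ℝ) : Set ℝ := {t | ∃ x y : M, τ x y = t} ∩ Set.Icc a b

/-- `C` is an `S`-code. -/
def IsCode (S : Set ℝ) (C : Finset M) : Prop :=
  ∀ x ∈ C, ∀ y ∈ C, x ≠ y → τ x y ∈ S

/-- The largest size of an `S`-code contained in `P` (it is `⊤` if the sizes are unbounded). -/
def maxCodeSize (P : Set M) (S : Set ℝ) : EReal :=
  ⨆ (C : Finset M) (_ : (C : Set M) ⊆ P ∧ IsCode τ S C), ((C.card : ℝ) : EReal)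

/-- The region of all `x` with `α i ≤ τ(x, q i) ≤ β i` for all `i`; the bounds may be infinite. -/
def region {r : ℕ} (q : Fin r → M) (α β : Fin r → EReal) : Set M :=
  {x | ∀ i, α i ≤ (τ x (q i) : EReal) ∧ (τ x (q i) : EReal) ≤ β i}

open Classical in
/-- The power sum of the `τ(x,y) ∈ I` over the ordered pairs of distinct points of `C`. -/
def powerSum (C : Finset M) (I : Set ℝ) (k : ℕ) : ℝ :=
  ∑ p ∈ C ×ˢ C with p.1 ≠ p.2 ∧ τ p.1 p.2 ∈ I, τ p.1 p.2 ^ k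

end Codes

/-- The pieces of `[a,b]` cut out by `a = u₁ < ⋯ < u_{ℓ+1} = b`: they are `[u_i, u_{i+1})` for
`i < ℓ`, and `[u_ℓ, b]` for `i = ℓ`. -/
def piece {ℓ : ℕ} (u : Fin (ℓ + 1) → ℝ) (i : Fin ℓ) : Set ℝ :=
  if (i : ℕ) + 1 = ℓ then Set.Icc (u i.castSucc) (u i.succ) else Set.Ico (u i.castSucc) (u i.succ)

/-! ### The constraints of the semidefinite program -/

/-- The Hankel matrix `R_m` with entries `s_{i+j}`. -/
def hankelR (m : ℕ) (s : ℕ → ℝ) : Matrix (Fin m) (Fin m) ℝ :=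
  Matrix.of fun i j => s (i + j)

/-- The matrix with entries `s_{i+j+1} - α s_{i+j}`; for infinite `α` there is no condition,
and the block is zero. -/
def hankelPlus (m : ℕ) (s : ℕ → ℝ) (α : EReal) : Matrix (Fin m) (Fin m) ℝ :=
  if α = ⊥ ∨ α = ⊤ then 0 else Matrix.of fun i j => s (i + j + 1) - α.toReal * s (i + j)

/-- The matrix with entries `β s_{i+j} - s_{i+j+1}`; for infinite `β` there is no condition,
and the block is zero. -/
def hankelMinus (m : ℕ) (s : ℕ → ℝ) (β : EReal) : Matrix (Fin m) (Fin m) ℝ :=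
  if β = ⊥ ∨ β = ⊤ then 0 else Matrix.of fun i j => β.toReal * s (i + j) - s (i + j + 1)

/-- The block diagonal matrix `H_m(s_0, …, s_{2m-1}, [α,β])`. -/
def hankelH (m : ℕ) (s : ℕ → ℝ) (α β : EReal) :
    Matrix (Fin m ⊕ (Fin m ⊕ Fin m)) (Fin m ⊕ (Fin m ⊕ Fin m)) ℝ :=
  Matrix.fromBlocks (hankelR m s) 0 0
    (Matrix.fromBlocks (hankelPlus m s α) 0 0 (hankelMinus m s β))

/-- An additional positive semidefinite constraint on the variables `c` and `x_i^{(k)}`: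
a linear matrix inequality with real symmetric matrices, in which the `x_i^{(k)}` with `k < deg`
may occur. -/
structure AdConstraint (ℓ : ℕ) where
  size : ℕ
  deg : ℕ
  const : Matrix (Fin size) (Fin size) ℝ
  coeffC : Matrix (Fin size) (Fin size) ℝ
  coeffX : Fin ℓ → Fin deg → Matrix (Fin size) (Fin size) ℝ
  const_symm : const.IsSymm
  coeffC_symm : coeffC.IsSymm
  coeffX_symm : ∀ i k, (coeffX i k).IsSymm

/-- The constraint holds at `c`, `x i k = x_i^{(k)}`. -/
def AdConstraint.Holds {ℓ : ℕ} (A : AdConstraint ℓ) (c : ℝ) (x : Fin ℓ → ℕ → ℝ) : Prop :=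
  (A.const + c • A.coeffC + ∑ i, ∑ k : Fin A.deg, x i k • A.coeffX i k).PosSemidef

/-- Every `S`-code in `P` satisfies all the additional constraints, with `c` the size of the code
and `x_i^{(k)}` its power sums over the `i`-th piece of `[a,b]`. -/
def AdValid {M : Type*} (τ : M → M → ℝ) (P : Set M) (S : Set ℝ) {ℓ : ℕ} (u : Fin (ℓ + 1) → ℝ)
    (Ad : Set (AdConstraint ℓ)) : Prop :=
  ∀ C : Finset M, (C : Set M) ⊆ P → IsCode τ S C →
    ∀ A ∈ Ad, A.Holds C.card (fun i k => powerSum τ C (piece u i) k)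

/-- The matrix `G_k`, written in the variables: with `Φ = ∑ d, p_d t^d` its entries are
`Φ(τ(q_i,q_j))`, in the last row and column `∑ d, p_d y_i^{(d)}`, and in the corner
`c + ∑ d, p_d ∑ i, x_i^{(d)}`. -/
def gramG {M : Type*} (τ : M → M → ℝ) {r ℓ : ℕ} (q : Fin r → M) (Φ : ℝ[X]) (c : ℝ)
    (x : Fin ℓ → ℕ → ℝ) (y : Fin r → ℕ → ℝ) : Matrix (Fin r ⊕ Unit) (Fin r ⊕ Unit) ℝ :=
  Matrix.fromBlocks
    (Matrix.of fun i j => Φ.eval (τ (q i) (q j)))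
    (Matrix.of fun i _ => ∑ d ∈ Finset.range (Φ.natDegree + 1), Φ.coeff d * y i d)
    (Matrix.of fun _ j => ∑ d ∈ Finset.range (Φ.natDegree + 1), Φ.coeff d * y j d)
    (Matrix.of fun _ _ =>
      c + ∑ d ∈ Finset.range (Φ.natDegree + 1), Φ.coeff d * ∑ i, x i d)

/-- Feasibility of `c`, `x i k = x_i^{(k)}`, `y i k = y_i^{(k)}` for the semidefinite program of
order `m`. The variables `x_i^{(k)}` with `k ≥ 2m` that occur in no additional constraint and the
`y_i^{(k)}` with `k ≥ 2m` occur in no constraint at all, so they are idle. -/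
structure Feasible {M : Type*} (τ : M → M → ℝ) {r ℓ : ℕ} (q : Fin r → M) (α β : Fin r → EReal)
    (D : ℕ∞) (Φ : ℕ → ℝ[X]) (u : Fin (ℓ + 1) → ℝ) (Ad : Set (AdConstraint ℓ)) (m : ℕ)
    (c : ℝ) (x : Fin ℓ → ℕ → ℝ) (y : Fin r → ℕ → ℝ) : Prop where
  hankel_x : ∀ i : Fin ℓ,
    (hankelH m (x i) (u i.castSucc : EReal) (u i.succ : EReal)).PosSemidef
  additional : ∀ A ∈ Ad, A.Holds c x
  gram : ∀ k : ℕ, k < 2 * m → (k : ℕ∞) ≤ D → (gramG τ q (Φ k) c x y).PosSemidef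
  y_zero : ∀ i : Fin r, y i 0 = c
  hankel_y : ∀ i : Fin r, (hankelH m (y i) (α i) (β i)).PosSemidef

/-- `c*(m)`: the optimal value of the semidefinite program of order `m`. -/
def cStar {M : Type*} (τ : M → M → ℝ) {r ℓ : ℕ} (q : Fin r → M) (α β : Fin r → EReal)
    (D : ℕ∞) (Φ : ℕ → ℝ[X]) (u : Fin (ℓ + 1) → ℝ) (Ad : Set (AdConstraint ℓ)) (m : ℕ) : EReal :=
  sSup {v : EReal | ∃ (c : ℝ) (x : Fin ℓ → ℕ → ℝ) (y : Fin r → ℕ → ℝ),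
    Feasible τ q α β D Φ u Ad m c x y ∧ v = (c : EReal)}

/-- The bound `SDPA`: the infimum of `c*(m)` over all `m ≥ 1`. -/
def sdpa {M : Type*} (τ : M → M → ℝ) {r ℓ : ℕ} (q : Fin r → M) (α β : Fin r → EReal)
    (D : ℕ∞) (Φ : ℕ → ℝ[X]) (u : Fin (ℓ + 1) → ℝ) (Ad : Set (AdConstraint ℓ)) : EReal :=
  ⨅ (m : ℕ) (_ : 1 ≤ m), cStar τ q α β D Φ u Ad m

end SDPCodes

end

open MeasureTheory Polynomial

namespace SDPCodes

/-! ### Positive semidefinite matrices -/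

/-! Every `S`-code `C` inside `P` yields a feasible point of the program of every order `m`, with
objective value `|C|`. The variables `x_i^{(k)}` are its power sums over the pieces of `[a,b]`, and
`y_i^{(k)} = ∑ z ∈ C, τ(z, q_i)^k`. Hence `|C| ≤ c*(m)` for all `m`, and the infimum over `m` is
still an upper bound (`feasible_of_isCode`).

Positivity always comes from a nonnegative combination of rank-one matrices `v vᵀ`. In the Hankel
blocks `v = (1, t, …, t^(m-1))`, with weights `1`, `t - α`, `β - t`. For `G_k`, the zonal expansion
makes `Φ_k(τ(x,y))` a positive definite kernel, and summing it over `{q_1}, …, {q_r}, C` in both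
arguments gives the entries of `G_k` (`gramG_posSemidef_of_expansion`). -/

theorem posSemidef_of_weighted_gram {ι n : Type*} [Finite n] (s : Finset ι) (w : ι → ℝ)
    (hw : ∀ p ∈ s, 0 ≤ w p) (v : ι → n → ℝ) (A : Matrix n n ℝ)
    (hA : ∀ i j, A i j = ∑ p ∈ s, w p * (v p i * v p j)) : A.PosSemidef := by
  have h : A = ∑ p ∈ s, w p • Matrix.vecMulVec (v p) (star (v p)) := by
    ext i j
    simp [hA, Matrix.sum_apply, Matrix.vecMulVec_apply]
  rw [h]
  refine Matrix.posSemidef_sum s fun p hp => ?_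
  exact (Matrix.posSemidef_vecMulVec_self_star (v p)).smul (hw p hp)

theorem posSemidef_fromBlocks_diagonal {m n : Type*} [Fintype m] [Fintype n]
    {A : Matrix m m ℝ} {B : Matrix n n ℝ} (hA : A.PosSemidef) (hB : B.PosSemidef) :
    (Matrix.fromBlocks A 0 0 B).PosSemidef := by
  refine Matrix.PosSemidef.of_dotProduct_mulVec_nonneg ?_ fun x => ?_
  · exact Matrix.IsHermitian.fromBlocks hA.1 (by simp) hB.1
  · have h1 := hA.dotProduct_mulVec_nonneg (x ∘ Sum.inl)
    have h2 := hB.dotProduct_mulVec_nonneg (x ∘ Sum.inr)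
    have h3 : star x ⬝ᵥ (Matrix.fromBlocks A 0 0 B).mulVec x
        = star (x ∘ Sum.inl) ⬝ᵥ A.mulVec (x ∘ Sum.inl)
          + star (x ∘ Sum.inr) ⬝ᵥ B.mulVec (x ∘ Sum.inr) := by
      simp [Matrix.fromBlocks_mulVec, dotProduct]
    rw [h3]
    exact add_nonneg h1 h2

/-- The moments of a finite point configuration in `[α,β]` satisfy the Hankel condition. -/
theorem hankelH_posSemidef_of_moments {ι : Type*} (m : ℕ) (T : Finset ι) (t : ι → ℝ)
    (s : ℕ → ℝ) (hs : ∀ k, s k = ∑ p ∈ T, t p ^ k) (α β : EReal)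
    (hα : ∀ p ∈ T, α ≤ (t p : EReal)) (hβ : ∀ p ∈ T, (t p : EReal) ≤ β) :
    (hankelH m s α β).PosSemidef := by
  refine posSemidef_fromBlocks_diagonal ?_ (posSemidef_fromBlocks_diagonal ?_ ?_)
  · refine posSemidef_of_weighted_gram T (fun _ => 1) (fun _ _ => zero_le_one)
      (fun p (i : Fin m) => t p ^ (i : ℕ)) _ fun i j => ?_
    simp [hankelR, hs, pow_add]
  · unfold hankelPlus
    split_ifs with h
    · exact .zero
    · push Not at h
      refine posSemidef_of_weighted_gram T (fun p => t p - α.toReal) (fun p hp => ?_)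
        (fun p (i : Fin m) => t p ^ (i : ℕ)) _ fun i j => ?_
      · have := hα p hp
        rw [← EReal.coe_toReal h.2 h.1, EReal.coe_le_coe_iff] at this
        linarith
      · simp only [Matrix.of_apply, hs, Finset.mul_sum, ← Finset.sum_sub_distrib]
        exact Finset.sum_congr rfl fun p _ => by ring
  · unfold hankelMinus
    split_ifs with h
    · exact .zero
    · push Not at h
      refine posSemidef_of_weighted_gram T (fun p => β.toReal - t p) (fun p hp => ?_)
        (fun p (i : Fin m) => t p ^ (i : ℕ)) _ fun i j => ?_
      · have := hβ p hp
        rw [← EReal.coe_toReal h.2 h.1, EReal.coe_le_coe_iff] at this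
        linarith
      · simp only [Matrix.of_apply, hs, Finset.mul_sum, ← Finset.sum_sub_distrib]
        exact Finset.sum_congr rfl fun p _ => by ring

/-! ### The partition of `[a,b]` -/

theorem piece_subset_Icc {ℓ : ℕ} (u : Fin (ℓ + 1) → ℝ) (i : Fin ℓ) :
    piece u i ⊆ Set.Icc (u i.castSucc) (u i.succ) := by
  unfold piece
  split_ifs
  · exact subset_rfl
  · exact Set.Ico_subset_Icc_self

theorem existsUnique_mem_piece {ℓ : ℕ} (hℓ : 1 ≤ ℓ) {u : Fin (ℓ + 1) → ℝ} (hu : StrictMono u)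
    {t : ℝ} (h0 : u 0 ≤ t) (h1 : t ≤ u (Fin.last ℓ)) : ∃! i, t ∈ piece u i := by
  classical
  have hne : (Finset.univ.filter fun i : Fin ℓ => u i.castSucc ≤ t).Nonempty :=
    ⟨⟨0, hℓ⟩, by simpa using h0⟩
  obtain ⟨i, hi, hmax⟩ := Finset.exists_max_image _ id hne
  simp only [Finset.mem_filter, Finset.mem_univ, true_and, id] at hi hmax
  -- Only the last piece is closed on the right, and `j < k` is not last: its points lie strictly
  -- below `u j.succ ≤ u k.castSucc`.
  have key : ∀ {j k : Fin ℓ}, j < k → t ∈ piece u j → t ∈ piece u k → False := by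
    intro j k hjk hj hk
    have hj' : (j : ℕ) + 1 ≠ ℓ := by have := k.isLt; have : (j : ℕ) < k := hjk; omega
    rw [piece, if_neg hj'] at hj
    have hk' := (piece_subset_Icc u k hk).1
    have : u j.succ ≤ u k.castSucc := hu.monotone (by
      rw [Fin.le_def]; simpa using Nat.succ_le_of_lt hjk)
    linarith [hj.2]
  have hi' : t ∈ piece u i := by
    simp only [piece]
    split_ifs with h
    · have : i.succ = Fin.last ℓ := Fin.ext (by simpa using h)
      exact ⟨hi, this ▸ h1⟩
    · refine ⟨hi, lt_of_not_ge fun hge => ?_⟩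
      have hlt : (i : ℕ) + 1 < ℓ := by have := i.isLt; omega
      have : (⟨i + 1, hlt⟩ : Fin ℓ) ≤ i := hmax ⟨i + 1, hlt⟩ hge
      rw [Fin.le_def] at this
      simp at this
  refine ⟨i, hi', fun j hj => ?_⟩
  rcases lt_trichotomy j i with h | h | h
  · exact (key h hj hi').elim
  · exact h
  · exact (key h hi' hj).elim

open Classical in
theorem sum_powerSum_piece {M : Type*} (τ : M → M → ℝ) {ℓ : ℕ} (hℓ : 1 ≤ ℓ)
    {u : Fin (ℓ + 1) → ℝ} (hu : StrictMono u) (C : Finset M)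
    (hC : IsCode τ (valueSet τ (u 0) (u (Fin.last ℓ))) C) (d : ℕ) :
    ∑ i, powerSum τ C (piece u i) d
      = ∑ p ∈ C ×ˢ C with p.1 ≠ p.2, τ p.1 p.2 ^ d := by
  have h : ∀ i, powerSum τ C (piece u i) d = ∑ p ∈ C ×ˢ C with p.1 ≠ p.2,
      if τ p.1 p.2 ∈ piece u i then τ p.1 p.2 ^ d else 0 := fun i => by
    rw [← Finset.sum_filter, Finset.filter_filter, powerSum]
  simp only [h]
  rw [Finset.sum_comm]
  refine Finset.sum_congr rfl fun p hp => ?_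
  simp only [Finset.mem_filter, Finset.mem_product] at hp
  obtain ⟨-, h0, h1⟩ := hC p.1 hp.1.1 p.2 hp.1.2 hp.2
  obtain ⟨i, hi, huniq⟩ := existsUnique_mem_piece hℓ hu h0 h1
  rw [Finset.sum_eq_single i (fun j _ hj => if_neg fun h => hj (huniq j h)) (by simp), if_pos hi]

/-- This is the corner entry of `G_k`. The pieces partition `[a,b]`, so the power sums collect all
pairs of distinct points, while each diagonal pair contributes `Φ(τ₀) = 1`, which gives the term
`|C|`. -/
theorem card_add_sum_powerSum_eq_sum_eval {M : Type*} (τ : M → M → ℝ) {ℓ : ℕ} (hℓ : 1 ≤ ℓ)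
    {u : Fin (ℓ + 1) → ℝ} (hu : StrictMono u) (C : Finset M)
    (hC : IsCode τ (valueSet τ (u 0) (u (Fin.last ℓ))) C) (Φ : ℝ[X])
    (hΦ : ∀ x, Φ.eval (τ x x) = 1) :
    (C.card : ℝ) + ∑ d ∈ Finset.range (Φ.natDegree + 1),
        Φ.coeff d * ∑ i, powerSum τ C (piece u i) d
      = ∑ x ∈ C, ∑ y ∈ C, Φ.eval (τ x y) := by
  classical
  have hoff : ∑ d ∈ Finset.range (Φ.natDegree + 1),
        Φ.coeff d * ∑ i, powerSum τ C (piece u i) d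
      = ∑ p ∈ C ×ˢ C with p.1 ≠ p.2, Φ.eval (τ p.1 p.2) := by
    simp only [sum_powerSum_piece τ hℓ hu C hC, Finset.mul_sum, eval_eq_sum_range]
    exact Finset.sum_comm
  have hdiag : (C.card : ℝ) = ∑ p ∈ C ×ˢ C with ¬ p.1 ≠ p.2, Φ.eval (τ p.1 p.2) := by
    have : ∀ p ∈ (C ×ˢ C).filter (fun p => ¬ p.1 ≠ p.2), Φ.eval (τ p.1 p.2) = 1 := by
      intro p hp
      have h : p.1 = p.2 := not_not.1 (Finset.mem_filter.1 hp).2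
      rw [h, hΦ]
    rw [Finset.sum_congr rfl this, Finset.sum_const, nsmul_one]
    simp only [not_not]
    rw [← C.diag_card]
    congr 2
    ext p
    aesop
  rw [hoff, hdiag, add_comm, Finset.sum_filter_add_sum_filter_not, Finset.sum_product]

/-! ### The Gram matrices -/

/-- Summing a separated kernel over `A × B` factors each term, so the sums of `f l` over sets serve
as Gram vectors. -/
theorem sum_sum_sum_mul {M ι : Type*} (A B : Finset M) (s : Finset ι) (κ : ℝ) (f : ι → M → ℝ) :
    ∑ x ∈ A, ∑ y ∈ B, ∑ l ∈ s, κ * (f l x * f l y)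
      = ∑ l ∈ s, κ * ((∑ x ∈ A, f l x) * ∑ y ∈ B, f l y) := by
  simp only [Finset.sum_mul_sum]
  simp only [Finset.mul_sum]
  rw [Finset.sum_comm (s := s)]
  exact Finset.sum_congr rfl fun _ _ => Finset.sum_comm

/-- A function `Φ(τ(x,y))` proportional to `∑ φ(x) conj φ(y)` is a positive definite kernel. -/
theorem gramG_posSemidef_of_expansion {M : Type*} (τ : M → M → ℝ) (hτ : ∀ x y, τ x y = τ y x)
    {r ℓ : ℕ} (q : Fin r → M) (Φ : ℝ[X]) (C : Finset M) (c : ℝ) (x : Fin ℓ → ℕ → ℝ)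
    {n : ℕ} (φ : Fin n → M → ℂ) (κ : ℝ) (hκ : 0 ≤ κ)
    (hexp : ∀ x y, ((Φ.eval (τ x y) : ℝ) : ℂ) = κ * ∑ i, φ i x * (starRingEnd ℂ) (φ i y))
    (hc : c + ∑ d ∈ Finset.range (Φ.natDegree + 1), Φ.coeff d * ∑ i, x i d
      = ∑ x ∈ C, ∑ y ∈ C, Φ.eval (τ x y)) :
    (gramG τ q Φ c x fun i k => ∑ z ∈ C, τ z (q i) ^ k).PosSemidef := by
  -- The kernel is real, so taking real parts loses nothing and replaces the `n` complex functions
  -- by `2n` real ones.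
  have hre : ∀ x y, Φ.eval (τ x y)
      = ∑ l, κ * ((φ l x).re * (φ l y).re) + ∑ l, κ * ((φ l x).im * (φ l y).im) := by
    intro x y
    have h := congrArg Complex.re (hexp x y)
    rw [Complex.ofReal_re, Complex.re_ofReal_mul, Complex.re_sum] at h
    rw [h, Finset.mul_sum, ← Finset.sum_add_distrib]
    refine Finset.sum_congr rfl fun l _ => ?_
    simp [Complex.mul_re]
    ring
  have hborder : ∀ i, ∑ d ∈ Finset.range (Φ.natDegree + 1), Φ.coeff d * ∑ z ∈ C, τ z (q i) ^ d
      = ∑ z ∈ C, Φ.eval (τ z (q i)) := by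
    intro i
    simp only [Finset.mul_sum, eval_eq_sum_range]
    exact Finset.sum_comm
  -- With one set of points per index, all four blocks take the same form.
  let S : Fin r ⊕ Unit → Finset M := Sum.elim (fun i => {q i}) fun _ => C
  have hG : ∀ i j, gramG τ q Φ c x (fun i k => ∑ z ∈ C, τ z (q i) ^ k) i j
      = ∑ x ∈ S i, ∑ y ∈ S j, Φ.eval (τ x y) := by
    rintro (i | i) (j | j)
    · simp [gramG, S]
    · simp [gramG, S, hborder, hτ (q i)]
    · simp [gramG, S, hborder]
    · simpa [gramG, S] using hc
  refine posSemidef_of_weighted_gram (Finset.univ : Finset (Fin n ⊕ Fin n)) (fun _ => κ)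
    (fun _ _ => hκ) (Sum.elim (fun l i => ∑ x ∈ S i, (φ l x).re)
      fun l i => ∑ x ∈ S i, (φ l x).im) _ fun i j => ?_
  rw [hG, Fintype.sum_sum_type]
  simp only [Sum.elim_inl, Sum.elim_inr, hre, Finset.sum_add_distrib, sum_sum_sum_mul]

/-- On the diagonal the expansion equates `1` with `κ` times a sum of squared moduli, which rules
out `κ < 0`. -/
theorem nonneg_of_expansion {n : ℕ} (z : Fin n → ℂ) (κ : ℝ)
    (h : (1 : ℂ) = κ * ∑ i, z i * (starRingEnd ℂ) (z i)) : 0 ≤ κ := by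
  have h' : (1 : ℝ) = κ * ∑ i, Complex.normSq (z i) := by
    simp only [Complex.mul_conj] at h
    exact_mod_cast h
  by_contra! hneg
  have := mul_nonpos_of_nonpos_of_nonneg hneg.le
    (Finset.sum_nonneg fun i (_ : i ∈ Finset.univ) => Complex.normSq_nonneg (z i))
  linarith

/-! ### The power sums of a code are feasible -/

theorem feasible_of_isCode {M : Type*} [MetricSpace M] [CompactSpace M] [MeasurableSpace M]
    [BorelSpace M] {G : Type*} [Group G] [MulAction G M] [IsIsometricSMul G M]
    (μ : Measure M) [IsProbabilityMeasure μ] (F : ℝ → ℝ) (τ : M → M → ℝ)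
    (hτ : ∀ x y, τ x y = F (dist x y)) (D : ℕ∞) (Φ : ℕ → ℝ[X]) (hΦ : IsZonalFamily G μ F D Φ)
    {ℓ : ℕ} (hℓ : 1 ≤ ℓ) (u : Fin (ℓ + 1) → ℝ) (hu : StrictMono u)
    {r : ℕ} (q : Fin r → M) (α β : Fin r → EReal) (P : Set M) (hP : P ⊆ region τ q α β)
    (Ad : Set (AdConstraint ℓ))
    (hAd : AdValid τ P (valueSet τ (u 0) (u (Fin.last ℓ))) u Ad)
    (C : Finset M) (hCP : (C : Set M) ⊆ P)
    (hC : IsCode τ (valueSet τ (u 0) (u (Fin.last ℓ))) C) (m : ℕ) :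
    Feasible τ q α β D Φ u Ad m C.card (fun i k => powerSum τ C (piece u i) k)
      (fun i k => ∑ z ∈ C, τ z (q i) ^ k) where
  hankel_x i := by
    classical
    refine hankelH_posSemidef_of_moments m
      ((C ×ˢ C).filter fun p => p.1 ≠ p.2 ∧ τ p.1 p.2 ∈ piece u i) (fun p => τ p.1 p.2) _
      (fun k => by unfold powerSum; congr!) _ _ (fun p hp => ?_) (fun p hp => ?_)
    · exact EReal.coe_le_coe_iff.2 (piece_subset_Icc u i (Finset.mem_filter.1 hp).2.2).1
    · exact EReal.coe_le_coe_iff.2 (piece_subset_Icc u i (Finset.mem_filter.1 hp).2.2).2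
  additional := hAd C hCP hC
  gram k _ hk := by
    obtain ⟨V, -, -, -, hV⟩ := hΦ
    obtain ⟨⟨n, φ, κ, -, -, hexp⟩, -, hone⟩ := hV k hk
    have hdiag : ∀ x, (Φ k).eval (τ x x) = 1 := fun x => by rw [hτ, dist_self, hone]
    simp only [← hτ] at hexp
    -- The sign of `κ` is read off at a point of `M`; one exists because a probability measure is
    -- nonzero.
    obtain ⟨x₀⟩ : Nonempty M := μ.nonempty_of_neZero
    refine gramG_posSemidef_of_expansion τ (fun x y => by rw [hτ, hτ, dist_comm]) q (Φ k) C _ _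
      (fun i x => φ i x) κ (nonneg_of_expansion (fun i => φ i x₀) κ ?_) hexp
      (card_add_sum_powerSum_eq_sum_eval τ hℓ hu C hC (Φ k) hdiag)
    simpa [hdiag] using hexp x₀ x₀
  y_zero i := by simp
  hankel_y i := hankelH_posSemidef_of_moments m C (fun z => τ z (q i)) _ (fun _ => rfl) _ _
    (fun z hz => (hP (hCP hz) i).1) (fun z hz => (hP (hCP hz) i).2)

end SDPCodes

theorem theorem7p2 {M : Type*} [MetricSpace M] [CompactSpace M] [MeasurableSpace M] [BorelSpace M]
    {G : Type*} [Group G] [MulAction G M] [IsIsometricSMul G M]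
    (hG : SDPCodes.IsTwoPointHomogeneous G M)
    (μ : MeasureTheory.Measure M) [MeasureTheory.IsProbabilityMeasure μ]
    [MeasureTheory.SMulInvariantMeasure G M μ]
    (F : ℝ → ℝ) (τ : M → M → ℝ) (hτ : ∀ x y, τ x y = F (dist x y))
    (D : ℕ∞) (Φ : ℕ → Polynomial ℝ) (hΦ : SDPCodes.IsZonalFamily G μ F D Φ)
    (a b : ℝ) (S : Set ℝ) (hS : S = SDPCodes.valueSet τ a b)
    {ℓ : ℕ} (hℓ : 1 ≤ ℓ) (u : Fin (ℓ + 1) → ℝ) (hu : StrictMono u)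
    (hua : u 0 = a) (hub : u (Fin.last ℓ) = b)
    {r : ℕ} (q : Fin r → M) (α β : Fin r → EReal) (hαβ : ∀ i, α i ≤ β i)
    (P : Set M) (hP : P ⊆ SDPCodes.region τ q α β)
    (Ad : Set (SDPCodes.AdConstraint ℓ)) (hAd : SDPCodes.AdValid τ P S u Ad) :
    SDPCodes.maxCodeSize τ P S ≤ SDPCodes.sdpa τ q α β D Φ u Ad ∧
      ∀ m : ℕ, 1 ≤ m →
        SDPCodes.sdpa τ q α β D Φ u Ad ≤ SDPCodes.cStar τ q α β D Φ u Ad m := by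
  subst hS hua hub
  refine ⟨le_iInf₂ fun m _ => iSup₂_le fun C hC => le_sSup ?_, fun m hm => iInf₂_le m hm⟩
  exact ⟨C.card, _, _, SDPCodes.feasible_of_isCode μ F τ hτ D Φ hΦ hℓ u hu q α β P hP Ad hAd C
    hC.1 hC.2 m, rfl⟩
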